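/- Throughout, a lattice is a finitely generated free $\mathbb Z$-module $L$ with a positive definite symmetric bilinear form $B:L\times L\to\mathbb Z$, and $Q(x)=B(x,x)$. A lattice $M$ is primitively represented by a lattice $L$ if there is an injective linear map $\sigma:M\to L$ preserving the bilinear forms such that $\sigma(M)$ is a direct summand of $L$. The genus of $L$ consists of all lattices that are isometric to $L$ over $\mathbb R$ and over $\mathbb Z_p$ for every prime $p$; a lattice is primitively represented by the genus of $L$ if it is primitively represented by some lattice in it. The lattice $L$ is strictly $k$-regular if it primitively represents every lattice of rank $k$ that is primitively represented by its genus. For $1\le i\le \operatorname{rank} L$, the $i$-th successive minimum $\mu_i(L)$ is the least $r$ such that $L$ contains $i$ linearly independent vectors $x$ with $Q(x)\le r$. Proposition 5.1. Let $n\ge 6$ and let $M$ be a lattice of rank $n$. There is a constant $C$, depending only on $M$, such that $\mu_{n+1}(L)\le C$ for every strictly $(n-3)$-regular lattice $L$ of rank greater than $n$ that primitively represents $M$. -/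

import Mathlib

open scoped TensorProduct

universe u

/-- A lattice: a finitely generated free `ℤ`-module carrying a positive definite symmetric
bilinear form with values in `ℤ` (the form is the bilinear form `B` of the ambient rational
quadratic space, restricted to the lattice; its quadratic map is `Q x = B x x`, so integrality
means that the scale, and not only the norm, is contained in `ℤ`). -/
structure PosDefLattice where
  carrier : Type u
  [addCommGroup : AddCommGroup carrier]
  [free : Module.Free ℤ carrier]
  [finite : Module.Finite ℤ carrier]
  form : LinearMap.BilinForm ℤ carrier
  symm : ∀ x y : carrier, form x y = form y x
  posDef : ∀ x : carrier, x ≠ 0 → 0 < form x x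

namespace PosDefLattice

attribute [instance] addCommGroup free finite

/-- The rank of a lattice. -/
noncomputable def rank (L : PosDefLattice.{u}) : ℕ := Module.finrank ℤ L.carrier

/-- `M` is primitively represented by `L`: there is an injective linear map from `M` to `L` that
preserves the bilinear forms and whose image is a direct summand of `L`. -/
def PrimitivelyRepresents (L M : PosDefLattice.{u}) : Prop :=
  ∃ σ : M.carrier →ₗ[ℤ] L.carrier,
    Function.Injective σ ∧
    (∀ x y : M.carrier, L.form (σ x) (σ y) = M.form x y) ∧
    ∃ N : Submodule ℤ L.carrier, IsCompl (LinearMap.range σ) N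

/-- `L` and `L'` become isometric after extending scalars from `ℤ` to `R`. -/
def IsometricOver (R : Type) [CommRing R] (L L' : PosDefLattice.{u}) : Prop :=
  ∃ e : (R ⊗[ℤ] L.carrier) ≃ₗ[R] (R ⊗[ℤ] L'.carrier),
    ∀ x y : R ⊗[ℤ] L.carrier,
      (L'.form.baseChange R) (e x) (e y) = (L.form.baseChange R) x y

/-- `L'` belongs to the genus of `L`: the two are isometric over `ℝ` and over `ℤ_p` for every
prime `p`. -/
def InGenus (L' L : PosDefLattice.{u}) : Prop :=
  IsometricOver ℝ L L' ∧ ∀ (p : ℕ) [Fact p.Prime], IsometricOver ℤ_[p] L L'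

/-- `K` is primitively represented by the genus of `L`, i.e. by some lattice in that genus. -/
def GenusPrimitivelyRepresents (L K : PosDefLattice.{u}) : Prop :=
  ∃ L' : PosDefLattice.{u}, L'.InGenus L ∧ L'.PrimitivelyRepresents K

/-- `L` is strictly `k`-regular: it primitively represents all lattices of rank `k` that are
primitively represented by its genus. -/
def IsStrictlyRegular (L : PosDefLattice.{u}) (k : ℕ) : Prop :=
  ∀ K : PosDefLattice.{u}, K.rank = k →
    L.GenusPrimitivelyRepresents K → L.PrimitivelyRepresents K

/-- The `i`-th successive minimum `μ_i(L)`, for `1 ≤ i ≤ rank L`: the least `r` such that `L`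
contains `i` linearly independent vectors `x` with `Q x ≤ r`. -/
noncomputable def successiveMinimum (L : PosDefLattice.{u}) (i : ℕ) : ℕ :=
  sInf {r : ℕ | ∃ v : Fin i → L.carrier,
    LinearIndependent ℤ v ∧ ∀ j : Fin i, L.form (v j) (v j) ≤ (r : ℤ)}

end PosDefLattice

/-! Write `n = k + 6` and let `d` be the Gram determinant of `M`. Choose an odd prime `p` not
dividing `d` for which `-d` is not a square modulo `p`. A lattice `N` of rank `k + 3 = n - 3` that
contains `k + 3` vectors, independent in `N/pN`, with Gram matrix `I_k ⊕ 0_3` modulo `p` cannot be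
primitively represented by `M`. Otherwise `M/pM` would be `I_k` plus a six-dimensional space with a
totally isotropic subspace of dimension three, and `-d` would be a square
(`isSquare_neg_det_of_radical`).

Such an `N` is built inside `M`, independently of `L`; it fails to be primitive only at `p`, because
it contains `p • b₂` but not `b₂`. Given `L` containing `M` primitively, choose `v` in `L` outside
`M` with `Q v` exactly divisible by `p`, and replace `L` at `p` by its image under the reflection in
`v`. This gives a lattice of the genus (`neighbor_inGenus`) which at `p` meets the space of `M` in
`{x ∈ M : p ∣ B(x, v)}`. By the choice of `v` (`exists_reflection_vector`) this excludes `b₂` and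
contains `N` primitively (`neighbor_primitivelyRepresents`).

Strict regularity then represents `N` primitively by `L` itself. Its image cannot lie in `M`, so
some basis vector of `N` is sent outside `M`. Together with a basis of `M` it gives `n + 1`
independent vectors whose lengths are bounded in terms of `M`. -/

/-! ### Direct summands and saturated submodules. -/

section Saturation

variable {E : Type*} [AddCommGroup E]

theorem mem_of_smul_mem_of_isCompl [Module.Free ℤ E] {N P : Submodule ℤ E} (h : IsCompl N P) {m : ℤ} (hm : m ≠ 0)
    {x : E} (hx : m • x ∈ N) : x ∈ N := by
  obtain ⟨a, ha, b, hb, rfl⟩ := Submodule.mem_sup.1 (h.sup_eq_top ▸ Submodule.mem_top : x ∈ N ⊔ P)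
  have hbN : m • b ∈ N := by
    have := N.sub_mem hx (N.smul_mem m ha)
    rwa [smul_add, add_sub_cancel_left] at this
  have h0 : m • b = 0 := Submodule.disjoint_def.1 h.disjoint _ hbN (P.smul_mem m hb)
  rw [smul_eq_zero_iff_right hm] at h0
  simpa [h0] using ha

/-- The quotient by `N` is finitely generated and torsion-free, hence free, so the projection onto
it splits. -/
theorem exists_isCompl_of_smul_mem [Module.Finite ℤ E] (N : Submodule ℤ E)
    (h : ∀ (m : ℤ) (x : E), m ≠ 0 → m • x ∈ N → x ∈ N) : ∃ P, IsCompl N P := by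
  have : Module.IsTorsionFree ℤ (E ⧸ N) := by
    constructor
    intro r hr x y hxy
    have hr0 : r ≠ 0 := hr.ne_zero
    obtain ⟨a, rfl⟩ := N.mkQ_surjective x
    obtain ⟨b, rfl⟩ := N.mkQ_surjective y
    have h1 : N.mkQ (r • (a - b)) = 0 := by
      simp only [map_smul, map_sub, smul_sub]
      exact sub_eq_zero.2 hxy
    rw [Submodule.mkQ_apply, Submodule.Quotient.mk_eq_zero] at h1
    have h2 := h r _ hr0 h1
    rw [← sub_eq_zero, ← map_sub, Submodule.mkQ_apply, Submodule.Quotient.mk_eq_zero]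
    exact h2
  have : Module.Free ℤ (E ⧸ N) := Module.free_of_finite_type_torsion_free'
  obtain ⟨g, hg⟩ := LinearMap.exists_rightInverse_of_surjective N.mkQ N.range_mkQ
  have hg' : ∀ y, N.mkQ (g y) = y := fun y => LinearMap.congr_fun hg y
  refine ⟨LinearMap.range g, ?_, ?_⟩
  · rw [Submodule.disjoint_def]
    rintro x hx ⟨y, rfl⟩
    have : N.mkQ (g y) = 0 := by simpa using hx
    rw [hg'] at this
    simp [this]
  · rw [codisjoint_iff, eq_top_iff]
    intro x _
    refine Submodule.mem_sup.2 ⟨x - g (N.mkQ x), ?_, g (N.mkQ x), ⟨_, rfl⟩, sub_add_cancel _ _⟩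
    rw [← Submodule.Quotient.mk_eq_zero, ← Submodule.mkQ_apply, map_sub, hg', sub_self]

theorem exists_functional_of_isCompl [Module.Free ℤ E] [Module.Finite ℤ E]
    {N P : Submodule ℤ E} (h : IsCompl N P)
    (hlt : Module.finrank ℤ N < Module.finrank ℤ E) :
    ∃ φ : E →ₗ[ℤ] ℤ, (∀ x ∈ N, φ x = 0) ∧ ∃ x, φ x = 1 := by
  have e := Submodule.prodEquivOfIsCompl N P h
  have hP : 0 < Module.finrank ℤ P := by
    have := e.finrank_eq
    rw [Module.finrank_prod] at this
    omega
  let b := Module.finBasis ℤ P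
  let i : Fin (Module.finrank ℤ P) := ⟨0, hP⟩
  refine ⟨b.coord i ∘ₗ P.projectionOnto N h.symm, fun x hx => ?_, b i, ?_⟩
  · simp [(Submodule.projectionOnto_apply_eq_zero_iff h.symm).2 hx]
  · simp [Submodule.projectionOnto_apply_left]

end Saturation

/-! ### Neighbors in the genus obtained from reflections. -/

namespace PosDefLattice

/-- Once `c` is invertible, `c⁻¹ S` is an isometry with inverse `c⁻¹ T`. This allows all maps to be
constructed over `ℤ`. -/
theorem isometricOver_of_similitude (R : Type) [CommRing R] {L L' : PosDefLattice.{u}} (c : ℤ)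
    (hc : IsUnit (c : R)) (S : L.carrier →ₗ[ℤ] L'.carrier) (T : L'.carrier →ₗ[ℤ] L.carrier)
    (hST : ∀ x, S (T x) = (c * c) • x) (hTS : ∀ x, T (S x) = (c * c) • x)
    (hS : ∀ x y, L'.form (S x) (S y) = c * c * L.form x y) : IsometricOver R L L' := by
  obtain ⟨w, hw⟩ := hc
  have hwc : ((w⁻¹ : Rˣ) : R) * c = 1 := by rw [← hw]; simp
  have key : ∀ {X Y : PosDefLattice.{u}} (A : X.carrier →ₗ[ℤ] Y.carrier)
      (B : Y.carrier →ₗ[ℤ] X.carrier), (∀ x, A (B x) = (c * c) • x) →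
      (((w⁻¹ : Rˣ) : R) • A.baseChange R) ∘ₗ (((w⁻¹ : Rˣ) : R) • B.baseChange R) =
        LinearMap.id := by
    intro X Y A B h
    ext x
    simp only [TensorProduct.AlgebraTensorModule.curry_apply, TensorProduct.curry_apply, LinearMap.coe_restrictScalars, LinearMap.comp_apply,
      LinearMap.smul_apply, LinearMap.baseChange_tmul, h, LinearMap.id_apply,
      TensorProduct.smul_tmul', TensorProduct.tmul_smul]
    rw [← Int.cast_smul_eq_zsmul R]
    congr 1
    simp only [smul_eq_mul, mul_one]
    push_cast
    linear_combination (((w⁻¹ : Rˣ) : R) * c + 1) * hwc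
  refine ⟨LinearEquiv.ofLinearMap _ _ (key S T hST) (key T S hTS), fun x y => ?_⟩
  simp only [LinearEquiv.coe_ofLinearMap, LinearMap.smul_apply, map_smul, smul_eq_mul]
  have hb : ∀ x y, (L'.form.baseChange R) (S.baseChange R x) (S.baseChange R y) =
      (c : R) * c * (L.form.baseChange R) x y := by
    intro x y
    induction x using TensorProduct.induction_on with
    | zero => simp
    | add a b ha hb => simp only [map_add, LinearMap.add_apply, ha, hb, mul_add]
    | tmul r a =>
      induction y using TensorProduct.induction_on with
      | zero => simp
      | add a b ha hb => simp only [map_add, ha, hb, mul_add]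
      | tmul s b =>
        simp only [LinearMap.baseChange_tmul, LinearMap.BilinForm.baseChange_tmul, hS, zsmul_eq_mul]
        push_cast
        ring
  rw [hb]
  linear_combination ((((w⁻¹ : Rˣ) : R) * c + 1) * (L.form.baseChange R) x y) * hwc

section Neighbor

variable (L : PosDefLattice.{u})

/-- `Q v` times the reflection in `v`. -/
def scaledReflection (v : L.carrier) : L.carrier →ₗ[ℤ] L.carrier :=
  L.form v v • LinearMap.id - ((2 : ℤ) • L.form.flip v).smulRight v

theorem scaledReflection_apply (v x : L.carrier) :
    L.scaledReflection v x = L.form v v • x - (2 * L.form x v) • v := by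
  simp [scaledReflection]

theorem form_scaledReflection (v x y : L.carrier) :
    L.form (L.scaledReflection v x) (L.scaledReflection v y) =
      L.form v v * L.form v v * L.form x y := by
  simp only [scaledReflection_apply, map_sub, map_smul, LinearMap.sub_apply, LinearMap.smul_apply,
    smul_eq_mul, L.symm v y]
  ring

theorem scaledReflection_scaledReflection (v x : L.carrier) :
    L.scaledReflection v (L.scaledReflection v x) = (L.form v v * L.form v v) • x := by
  simp only [scaledReflection_apply, map_sub, map_smul]
  module

/-- The vectors of `L` sent into `p ^ 2 L` by `Q v` times the reflection in `v`. -/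
def neighborSubmodule (v : L.carrier) (p : ℕ) : Submodule ℤ L.carrier :=
  (LinearMap.range (LinearMap.lsmul ℤ L.carrier ((p : ℤ) ^ 2))).comap
    (L.scaledReflection v)

theorem mem_neighborSubmodule {v : L.carrier} {p : ℕ} {x : L.carrier} :
    x ∈ L.neighborSubmodule v p ↔ ∃ y, L.scaledReflection v x = ((p : ℤ) ^ 2) • y := by
  simp [neighborSubmodule, LinearMap.mem_range, eq_comm]

variable {L} {v : L.carrier} {p : ℕ} {t : ℤ}

/-- The scaled reflection multiplies the form by `p² t²` and sends both vectors into `p² L`;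
cancelling `p²` leaves `p² ∣ t² B(x, y)`, and `t` is prime to `p`. -/
theorem sq_dvd_form_of_mem_neighborSubmodule (hp : p.Prime) (hv : L.form v v = p * t)
    (ht : ¬ (p : ℤ) ∣ t) {x y : L.carrier} (hx : x ∈ L.neighborSubmodule v p)
    (hy : y ∈ L.neighborSubmodule v p) : (p : ℤ) ^ 2 ∣ L.form x y := by
  obtain ⟨x', hx'⟩ := (mem_neighborSubmodule L).1 hx
  obtain ⟨y', hy'⟩ := (mem_neighborSubmodule L).1 hy
  have h := L.form_scaledReflection v x y
  rw [hx', hy', hv] at h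
  simp only [map_smul, LinearMap.smul_apply, smul_eq_mul] at h
  have hp0 : (p : ℤ) ^ 2 ≠ 0 := by have := hp.ne_zero; positivity
  have h2 : (p : ℤ) ^ 2 * L.form x' y' = t ^ 2 * L.form x y := by
    apply mul_left_cancel₀ hp0
    linear_combination h
  have hco : IsCoprime ((p : ℤ) ^ 2) (t ^ 2) :=
    ((Nat.prime_iff_prime_int.1 hp).coprime_iff_not_dvd.2 ht).pow
  exact hco.dvd_of_dvd_mul_left ⟨_, h2.symm⟩

/-- The lattice which is the image of `L` under the reflection in `v` at `p` and agrees with `L`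
at all other primes, scaled by `p` so that it becomes a sublattice of `L`. -/
noncomputable def neighbor (hp : p.Prime) (hv : L.form v v = p * t) (ht : ¬ (p : ℤ) ∣ t) :
    PosDefLattice.{u} where
  carrier := L.neighborSubmodule v p
  form := LinearMap.mk₂ ℤ (fun x y => L.form x y / (p : ℤ) ^ 2)
    (fun x x' y => by
      simp only [Submodule.coe_add, map_add, LinearMap.add_apply]
      exact Int.add_ediv_of_dvd_left (sq_dvd_form_of_mem_neighborSubmodule hp hv ht x.2 y.2))
    (fun c x y => by
      simp only [Submodule.coe_smul, map_smul, LinearMap.smul_apply, smul_eq_mul]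
      exact Int.mul_ediv_assoc _ (sq_dvd_form_of_mem_neighborSubmodule hp hv ht x.2 y.2))
    (fun x y y' => by
      simp only [Submodule.coe_add, map_add]
      exact Int.add_ediv_of_dvd_left (sq_dvd_form_of_mem_neighborSubmodule hp hv ht x.2 y.2))
    (fun c x y => by
      simp only [Submodule.coe_smul, map_smul, smul_eq_mul]
      exact Int.mul_ediv_assoc _ (sq_dvd_form_of_mem_neighborSubmodule hp hv ht x.2 y.2))
  symm x y := by simp [L.symm x.1 y.1]
  posDef x hx := by
    have hp0 : 0 < (p : ℤ) ^ 2 := by have := hp.pos; positivity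
    have h := L.posDef x.1 (by simpa using hx)
    obtain ⟨s, hs⟩ := sq_dvd_form_of_mem_neighborSubmodule hp hv ht x.2 x.2
    simp only [LinearMap.mk₂_apply, hs]
    rw [Int.mul_ediv_cancel_left _ hp0.ne']
    rw [hs] at h
    exact pos_of_mul_pos_right h hp0.le

theorem sq_mul_neighbor_form (hp : p.Prime) (hv : L.form v v = p * t) (ht : ¬ (p : ℤ) ∣ t)
    (x y : L.neighborSubmodule v p) :
    (p : ℤ) ^ 2 * (neighbor hp hv ht).form x y = L.form x.1 y.1 :=
  Int.mul_ediv_cancel' (sq_dvd_form_of_mem_neighborSubmodule hp hv ht x.2 y.2)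

theorem isometricOver_neighbor_of_isUnit (R : Type) [CommRing R] (hp : p.Prime)
    (hv : L.form v v = p * t) (ht : ¬ (p : ℤ) ∣ t) (hR : IsUnit ((p : ℤ) : R)) :
    IsometricOver R L (neighbor hp hv ht) := by
  have hp0 : (p : ℤ) ^ 2 ≠ 0 := by have := hp.ne_zero; positivity
  -- Multiplication by `p²` scales the form by `p⁴ / p² = p²`; the map back is the inclusion.
  refine isometricOver_of_similitude R (p : ℤ) hR
    (LinearMap.codRestrict (L.neighborSubmodule v p) (LinearMap.lsmul ℤ L.carrier ((p : ℤ) ^ 2))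
      fun x => (mem_neighborSubmodule L).2 ⟨L.scaledReflection v x, by simp⟩)
    (L.neighborSubmodule v p).subtype (fun x => ?_) (fun x => ?_) (fun x y => ?_)
  · exact Subtype.ext (congrArg (· • x.1) (sq (p : ℤ)))
  · exact congrArg (· • x) (sq (p : ℤ))
  · apply mul_left_cancel₀ hp0
    refine (sq_mul_neighbor_form hp hv ht _ _).trans ?_
    change L.form (((p : ℤ) ^ 2) • x) (((p : ℤ) ^ 2) • y) = _
    simp only [map_smul, LinearMap.smul_apply, smul_eq_mul]
    ring

theorem isometricOver_neighbor_of_isUnit_cofactor (R : Type) [CommRing R] (hp : p.Prime)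
    (hv : L.form v v = p * t) (ht : ¬ (p : ℤ) ∣ t) (hR : IsUnit (t : R)) :
    IsometricOver R L (neighbor hp hv ht) := by
  have hp0 : (p : ℤ) ^ 2 ≠ 0 := by have := hp.ne_zero; positivity
  have hex : ∀ x : L.neighborSubmodule v p, ∃ y, L.scaledReflection v x = ((p : ℤ) ^ 2) • y :=
    fun x => (mem_neighborSubmodule L).1 x.2
  choose T hT using hex
  let T' : L.neighborSubmodule v p →ₗ[ℤ] L.carrier :=
    { toFun := T
      map_add' := fun x y => by
        apply smul_right_injective _ hp0
        simp only [smul_add, ← hT, Submodule.coe_add, map_add]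
      map_smul' := fun c x => by
        apply smul_right_injective _ hp0
        simp only [smul_comm _ c, ← hT, Submodule.coe_smul, map_smul, RingHom.id_apply] }
  have hS : ∀ x, L.scaledReflection v x ∈ L.neighborSubmodule v p := fun x =>
    (mem_neighborSubmodule L).2 ⟨(t * t) • x, by
      rw [scaledReflection_scaledReflection, hv, smul_smul]; ring_nf⟩
  -- The scaled reflection scales the form by `(p t)² / p² = t²`; the map back is the scaled
  -- reflection divided by `p²`.
  refine isometricOver_of_similitude R t hR
    (LinearMap.codRestrict (L.neighborSubmodule v p) (L.scaledReflection v) hS)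
    T' (fun x => Subtype.ext (smul_right_injective _ hp0 ?_))
    (fun x => smul_right_injective _ hp0 ?_) (fun x y => mul_left_cancel₀ hp0 ?_)
  · refine ((map_smul _ _ _).symm.trans (congrArg (L.scaledReflection v) (hT x).symm)).trans ?_
    change _ = ((p : ℤ) ^ 2) • ((t * t) • x.1)
    rw [scaledReflection_scaledReflection, hv, smul_smul]
    ring_nf
  · refine (hT ⟨_, hS x⟩).symm.trans ?_
    change _ = ((p : ℤ) ^ 2) • ((t * t) • x)
    rw [scaledReflection_scaledReflection, hv, smul_smul]
    ring_nf
  · refine (sq_mul_neighbor_form hp hv ht ⟨_, hS x⟩ ⟨_, hS y⟩).trans ?_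
    rw [form_scaledReflection, hv]
    ring

/-- At `p` the cofactor `t` is a unit; over `ℝ` and at every other prime `p` is a unit. -/
theorem neighbor_inGenus (hp : p.Prime) (hv : L.form v v = p * t) (ht : ¬ (p : ℤ) ∣ t) :
    (neighbor hp hv ht).InGenus L := by
  refine ⟨isometricOver_neighbor_of_isUnit ℝ hp hv ht ?_, fun q hq => ?_⟩
  · have := hp.ne_zero
    simpa using this
  · by_cases h : p = q
    · subst h
      refine isometricOver_neighbor_of_isUnit_cofactor ℤ_[p] hp hv ht ?_
      rw [PadicInt.isUnit_iff]
      by_contra hne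
      exact ht (PadicInt.norm_int_lt_one_iff_dvd t |>.1 (lt_of_le_of_ne (PadicInt.norm_le_one _) hne))
    · refine isometricOver_neighbor_of_isUnit ℤ_[q] hp hv ht ?_
      rw [PadicInt.isUnit_iff]
      by_contra hne
      have := PadicInt.norm_int_lt_one_iff_dvd (p : ℤ) |>.1
        (lt_of_le_of_ne (PadicInt.norm_le_one _) hne)
      rw [Int.natCast_dvd_natCast, Nat.prime_dvd_prime_iff_eq hq.out hp] at this
      exact h this.symm

end Neighbor

end PosDefLattice

/-! ### Choice of the prime. -/

/-- Modulo `4 d - 1` the number `d` is inverse to the square `4`, so its Jacobi symbol is `1`; as `4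
d - 1 ≡ 3` modulo `4`, that of `-d` is `-1`, and some prime factor inherits the sign. -/
theorem exists_prime_not_isSquare_neg (d : ℕ) (hd : 0 < d) :
    ∃ p : ℕ, p.Prime ∧ p ≠ 2 ∧ (d : ZMod p) ≠ 0 ∧ ¬ IsSquare (-(d : ZMod p)) := by
  have hodd : Odd (4 * d - 1) := by
    rw [Nat.odd_iff]; omega
  have h4 : jacobiSym (d : ℤ) (4 * d - 1) = 1 := by
    have hc : (4 : ℤ).gcd ((4 * d - 1 : ℕ) : ℤ) = 1 := by
      have : Nat.Coprime (2 ^ 2) (4 * d - 1) :=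
        Nat.Coprime.pow_left 2 (Nat.coprime_two_left.2 hodd)
      exact_mod_cast this
    have h1 : jacobiSym (4 * d : ℤ) (4 * d - 1) = 1 := by
      rw [jacobiSym.mod_left' (b := 4 * d - 1) (a₂ := 1), jacobiSym.one_left]
      apply Int.ModEq.symm
      rw [Int.modEq_iff_dvd]
      exact ⟨1, by push_cast [show 1 ≤ 4 * d by omega]; ring⟩
    rw [jacobiSym.mul_left, show (4 : ℤ) = 2 ^ 2 by norm_num] at h1
    rw [jacobiSym.sq_one', one_mul] at h1
    · exact h1
    · rw [Int.gcd_eq_natAbs]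
      simpa using hodd
  have hneg : jacobiSym (-(d : ℤ)) (4 * d - 1) = -1 := by
    rw [jacobiSym.neg _ hodd, h4, mul_one, ZMod.χ₄_nat_three_mod_four (by omega)]
  obtain ⟨p, hp, hdvd, hsym⟩ := jacobiSym.eq_neg_one_at_prime_divisor_of_eq_neg_one hneg
  have := Fact.mk hp
  have hns : ¬ IsSquare (-(d : ZMod p)) := by
    rw [← jacobiSym.legendreSym.to_jacobiSym, legendreSym.eq_neg_one_iff] at hsym
    simpa using hsym
  refine ⟨p, hp, ?_, fun h => hns (by simp [h]), hns⟩
  rintro rfl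
  exact (Nat.not_even_iff_odd.2 hodd) (even_iff_two_dvd.2 hdvd)

/-! ### Quadratic spaces over a finite field of odd characteristic. -/

section FiniteField

variable {F : Type*} [Field F]

theorem exists_mul_sq_add_mul_sq_eq [Fintype F] (hF : ringChar F ≠ 2) {a b : F} (ha : a ≠ 0)
    (hb : b ≠ 0) (c : F) : ∃ x y : F, a * x ^ 2 + b * y ^ 2 = c := by
  obtain ⟨x, y, h⟩ := FiniteField.exists_root_sum_quadratic
    (f := Polynomial.C a * Polynomial.X ^ 2) (g := Polynomial.C b * Polynomial.X ^ 2
      - Polynomial.C c) (by simpa using Polynomial.degree_C_mul_X_pow 2 ha)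
    (by
      rw [Polynomial.degree_sub_C, Polynomial.degree_C_mul_X_pow 2 hb]
      · rfl
      · rw [Polynomial.degree_C_mul_X_pow 2 hb]; norm_num)
    (FiniteField.odd_card_of_char_ne_two hF)
  exact ⟨x, y, by simp at h; linear_combination h⟩

/-- A nondegenerate binary form represents `1`, so unit vectors can be split off until a line is
left; `δ` is the value on that line. -/
theorem exists_orthogonal_family [Fintype F] (hF : ringChar F ≠ 2) (m : ℕ) :
    ∀ {V : Type} [AddCommGroup V] [Module F V] [FiniteDimensional F V]
      (B : LinearMap.BilinForm F V), B.IsSymm → B.Nondegenerate → Module.finrank F V = m + 1 →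
      ∃ (v : Fin (m + 1) → V) (δ : F), δ ≠ 0 ∧
        ∀ i j, B (v i) (v j) = if i = j then (if i = 0 then δ else 1) else 0 := by
  let : Invertible (2 : F) := invertibleOfNonzero (Ring.two_ne_zero hF)
  induction m with
  | zero =>
    intro V _ _ _ B hs hB hV
    have : Nontrivial V := Module.nontrivial_of_finrank_pos (R := F) (by omega)
    have hB0 : B ≠ 0 := by
      rintro rfl
      obtain ⟨x, hx⟩ := exists_ne (0 : V)
      exact hx (hB.1 x (by simp))
    obtain ⟨x, hx⟩ := LinearMap.BilinForm.exists_bilinForm_self_ne_zero hB0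
      (LinearMap.BilinForm.isSymm_iff.1 hs)
    exact ⟨fun _ => x, B x x, hx, fun i j => by
      have hi : i = 0 := by omega
      have hj : j = 0 := by omega
      simp [hi, hj]⟩
  | succ m ih =>
    intro V _ _ _ B hs hB hV
    obtain ⟨w, hw⟩ := LinearMap.BilinForm.exists_orthogonal_basis (LinearMap.BilinForm.isSymm_iff.1 hs)
    have hne : ∀ i, B (w i) (w i) ≠ 0 := by
      intro i
      exact LinearMap.BilinForm.iIsOrtho.not_isOrtho_basis_self_of_nondegenerate hw hB i
    let i0 : Fin (Module.finrank F V) := ⟨0, by omega⟩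
    let i1 : Fin (Module.finrank F V) := ⟨1, by omega⟩
    have h01 : i0 ≠ i1 := by simp [i0, i1]
    obtain ⟨x, y, hxy⟩ := exists_mul_sq_add_mul_sq_eq hF (hne i0) (hne i1) 1
    set e := x • w i0 + y • w i1 with he
    have hee : B e e = 1 := by
      have h1 : B (w i0) (w i1) = 0 := hw h01
      have h2 : B (w i1) (w i0) = 0 := hw h01.symm
      simp only [he, map_add, map_smul, LinearMap.add_apply, LinearMap.smul_apply, smul_eq_mul,
        h1, h2]
      linear_combination hxy
    have hee0 : B e e ≠ 0 := by simp [hee]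
    have hcompl := LinearMap.BilinForm.isCompl_span_singleton_orthogonal hee0
    have hrank : Module.finrank F (B.orthogonal (F ∙ e)) = m + 1 := by
      have h1 := Submodule.finrank_add_eq_of_isCompl hcompl
      rw [finrank_span_singleton (by rintro h; simp [h] at hee0)] at h1
      omega
    obtain ⟨v, δ, hδ, hv⟩ := ih (B.restrict (B.orthogonal (F ∙ e))) (hs.restrict _)
      (LinearMap.BilinForm.restrict_nondegenerate_orthogonal_spanSingleton B hB hs.isRefl hee0)
      hrank
    have hev : ∀ i, B e (v i) = 0 := fun i => (v i).2 e (Submodule.mem_span_singleton_self e)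
    refine ⟨Fin.snoc (fun i => (v i : V)) e, δ, hδ, fun i j => ?_⟩
    refine Fin.lastCases ?_ (fun i => ?_) i <;> refine Fin.lastCases ?_ (fun j => ?_) j
    · simp [hee, Fin.last_eq_zero_iff]
    · simp [hev, (Fin.castSucc_lt_last j).ne']
    · have : B (v i) e = 0 := by rw [hs.eq, hev]
      simp [this, (Fin.castSucc_lt_last i).ne]
    · have := hv i j
      simp only [LinearMap.BilinForm.restrict_apply, LinearMap.domRestrict_apply] at this
      simp [this]

theorem det_fromBlocks_zero_transpose (Y Z : Matrix (Fin 3) (Fin 3) F) :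
    (Matrix.fromBlocks 0 Y Y.transpose Z).det = -(Y.det) ^ 2 := by
  have hJ : (Matrix.fromBlocks (0 : Matrix (Fin 3) (Fin 3) F) (1 : Matrix (Fin 3) (Fin 3) F) 1 0).det = -1 := by
    have h : (Matrix.fromBlocks (0 : Matrix (Fin 3) (Fin 3) F) (1 : Matrix (Fin 3) (Fin 3) F) 1 0) =
        Matrix.fromBlocks (1 : Matrix (Fin 3) (Fin 3) F) (1 : Matrix (Fin 3) (Fin 3) F) 0 1 *
          Matrix.fromBlocks (-1) 0 (1 : Matrix (Fin 3) (Fin 3) F) 1 *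
          Matrix.fromBlocks (1 : Matrix (Fin 3) (Fin 3) F) (-1) 0 1 := by
      simp [Matrix.fromBlocks_multiply]
    rw [h, Matrix.det_mul, Matrix.det_mul, Matrix.det_fromBlocks_zero₂₁,
      Matrix.det_fromBlocks_zero₂₁, Matrix.det_fromBlocks_zero₁₂, Matrix.det_neg]
    simp
    norm_num
  have h : Matrix.fromBlocks 0 Y Y.transpose Z *
      Matrix.fromBlocks 0 (1 : Matrix (Fin 3) (Fin 3) F) (1 : Matrix (Fin 3) (Fin 3) F) 0 =
      Matrix.fromBlocks Y 0 Z Y.transpose := by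
    simp [Matrix.fromBlocks_multiply]
  have h2 := congrArg Matrix.det h
  rw [Matrix.det_mul, hJ, Matrix.det_fromBlocks_zero₁₂, Matrix.det_transpose] at h2
  linear_combination -h2

theorem exists_det_toMatrix_eq_mul_sq {V : Type*} [AddCommGroup V] [Module F V]
    (B : LinearMap.BilinForm F V) {ι κ : Type*} [Fintype ι] [DecidableEq ι] [Fintype κ]
    [DecidableEq κ] (b : Module.Basis ι F V) (c : Module.Basis κ F V) :
    ∃ a : F, a ≠ 0 ∧ (LinearMap.BilinForm.toMatrix c B).det =
      (LinearMap.BilinForm.toMatrix b B).det * a ^ 2 := by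
  have hι : Fintype.card ι = Fintype.card κ := by
    rw [← Module.finrank_eq_card_basis b, ← Module.finrank_eq_card_basis c]
  let b' := b.reindex (Fintype.equivOfCardEq hι)
  have hb' : (LinearMap.BilinForm.toMatrix b' B).det = (LinearMap.BilinForm.toMatrix b B).det := by
    rw [← Matrix.det_submatrix_equiv_self (Fintype.equivOfCardEq hι).symm]
    congr 1
    ext i j
    simp [b', LinearMap.BilinForm.toMatrix_apply]
  refine ⟨(b'.toMatrix c).det, ?_, ?_⟩
  · have := congrArg Matrix.det (b'.toMatrix_mul_toMatrix_flip c)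
    rw [Matrix.det_mul, Matrix.det_one] at this
    exact left_ne_zero_of_mul_eq_one this
  · rw [← LinearMap.BilinForm.toMatrix_mul_basis_toMatrix b' c B, Matrix.det_mul, Matrix.det_mul,
      Matrix.det_transpose, hb']
    ring

/-- Splitting off the `k` unit vectors leaves a six-dimensional space with a three-dimensional
totally isotropic subspace, whose determinant is `-(det Y)²`. A change of basis alters determinants
by squares only. -/
theorem isSquare_neg_det_of_radical {V : Type*} [AddCommGroup V] [Module F V]
    [FiniteDimensional F V] (B : LinearMap.BilinForm F V) (hB : B.IsSymm) {ι : Type*} [Fintype ι]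
    [DecidableEq ι] (b : Module.Basis ι F V) {k : ℕ} (hV : Module.finrank F V = k + 6)
    (g : Fin k ⊕ Fin 3 → V) (hg : LinearIndependent F g)
    (hgram : ∀ i j, B (g i) (g j) = if i = j ∧ i.isLeft then 1 else 0) :
    IsSquare (-(LinearMap.BilinForm.toMatrix b B).det) := by
  classical
  let c₀ := Module.Basis.sumExtend hg
  have : Finite (Module.Basis.sumExtendIndex hg) := by
    have := Module.Finite.finite_basis c₀
    exact Finite.of_injective (Sum.inr : _ → (Fin k ⊕ Fin 3) ⊕ _) Sum.inr_injective
  have hcard : Nat.card (Module.Basis.sumExtendIndex hg) = 3 := by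
    have := Module.finrank_eq_nat_card_basis c₀
    rw [hV] at this
    have hfin := Fintype.ofFinite (Module.Basis.sumExtendIndex hg)
    simp only [Nat.card_eq_fintype_card, Fintype.card_fin, Fintype.card_sum] at this
    rw [Nat.card_eq_fintype_card]
    omega
  let e : Module.Basis.sumExtendIndex hg ≃ Fin 3 := Finite.equivFinOfCardEq hcard
  let c : Module.Basis (Fin k ⊕ (Fin 3 ⊕ Fin 3)) F V :=
    c₀.reindex (((Equiv.refl _).sumCongr e).trans (Equiv.sumAssoc _ _ _))
  have hc1 : ∀ i, c (Sum.inl i) = g (Sum.inl i) := by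
    intro i; simp [c, c₀, Module.Basis.sumExtend]; rfl
  have hc2 : ∀ i, c (Sum.inr (Sum.inl i)) = g (Sum.inr i) := by
    intro i; simp [c, c₀, Module.Basis.sumExtend]; rfl
  let G := LinearMap.BilinForm.toMatrix c B
  obtain ⟨X, hX⟩ : ∃ X : Matrix (Fin k) (Fin 3) F, ∀ i j, X i j =
    B (c (Sum.inl i)) (c (Sum.inr (Sum.inr j))) := ⟨_, fun _ _ => rfl⟩
  obtain ⟨Y, hY⟩ : ∃ Y : Matrix (Fin 3) (Fin 3) F, ∀ i j, Y i j =
    B (c (Sum.inr (Sum.inl i))) (c (Sum.inr (Sum.inr j))) := ⟨_, fun _ _ => rfl⟩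
  obtain ⟨Z, hZ⟩ : ∃ Z : Matrix (Fin 3) (Fin 3) F, ∀ i j, Z i j =
    B (c (Sum.inr (Sum.inr i))) (c (Sum.inr (Sum.inr j))) := ⟨_, fun _ _ => rfl⟩
  have hG : G = Matrix.fromBlocks 1 (Matrix.fromCols 0 X) (Matrix.fromRows 0 X.transpose)
      (Matrix.fromBlocks 0 Y Y.transpose Z) := by
    ext i j
    rcases i with i | i | i <;> rcases j with j | j | j <;>
      simp [G, LinearMap.BilinForm.toMatrix_apply, hc1, hc2, hgram, hX, hY, hZ, Matrix.one_apply]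
    · exact hB.eq _ _
    · exact hB.eq _ _
  have hdet : G.det = -(Y.det) ^ 2 := by
    -- The Schur complement of the identity block changes only `Z`, since the isotropic vectors are
    -- orthogonal to the unit vectors.
    rw [hG, Matrix.det_fromBlocks_one₁₁, ← det_fromBlocks_zero_transpose Y (Z - X.transpose * X)]
    congr 1
    ext i j
    rcases i with i | i <;> rcases j with j | j <;>
      simp [Matrix.fromRows_mul, Matrix.mul_fromCols, Matrix.mul_apply]
  obtain ⟨a, ha, h⟩ := exists_det_toMatrix_eq_mul_sq B b c
  change G.det = _ at h
  rw [hdet] at h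
  refine ⟨Y.det / a, ?_⟩
  field_simp
  linear_combination h

end FiniteField

/-! ### Reduction of a lattice modulo `p`. -/

namespace PosDefLattice

variable (M : PosDefLattice.{u}) {ι : Type} (m : Module.Basis ι ℤ M.carrier)

/-- The coordinates of a lattice vector, cast into a ring. -/
noncomputable def coords (R : Type) [CommRing R] : M.carrier →ₗ[ℤ] (ι → R) where
  toFun x i := (m.repr x i : R)
  map_add' x y := by ext i; simp
  map_smul' c x := by ext i; simp

theorem coords_apply (R : Type) [CommRing R] (x : M.carrier) (i : ι) :
    M.coords m R x i = (m.repr x i : R) := rfl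

variable [Fintype ι]

theorem exists_smul_of_coords_eq_zero {p : ℕ} {x : M.carrier}
    (hx : M.coords m (ZMod p) x = 0) : ∃ y, x = (p : ℤ) • y := by
  have h : ∀ i, (p : ℤ) ∣ m.repr x i := fun i =>
    (ZMod.intCast_zmod_eq_zero_iff_dvd _ p).1 (congrFun hx i)
  choose z hz using h
  refine ⟨∑ i, z i • m i, ?_⟩
  conv_lhs => rw [← m.sum_repr x]
  simp only [Finset.smul_sum, smul_smul, hz]

theorem coords_surjective (p : ℕ) : Function.Surjective (M.coords m (ZMod p)) := by
  intro y
  choose z hz using fun i => ZMod.intCast_surjective (n := p) (y i)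
  refine ⟨∑ i, z i • m i, ?_⟩
  ext i
  rw [coords_apply, m.repr_sum_self, hz]

variable [DecidableEq ι]

/-- The form with the Gram matrix of a lattice basis, over an arbitrary ring. -/
noncomputable def coordForm (R : Type) [CommRing R] : LinearMap.BilinForm R (ι → R) :=
  Matrix.toBilin' ((LinearMap.BilinForm.toMatrix m M.form).map (Int.cast : ℤ → R))

theorem coordForm_coords (R : Type) [CommRing R] (x y : M.carrier) :
    M.coordForm m R (M.coords m R x) (M.coords m R y) = (M.form x y : R) := by
  conv_rhs => rw [← m.sum_repr x, ← m.sum_repr y]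
  simp only [coordForm, Matrix.toBilin'_apply, coords_apply, Matrix.map_apply,
    LinearMap.BilinForm.toMatrix_apply, map_sum, map_smul, LinearMap.sum_apply,
    LinearMap.smul_apply, smul_eq_mul]
  push_cast
  rw [Finset.sum_comm]
  exact Finset.sum_congr rfl fun i _ => by
    rw [Finset.mul_sum]
    exact Finset.sum_congr rfl fun j _ => by ring

theorem coordForm_isSymm (R : Type) [CommRing R] : (M.coordForm m R).IsSymm := by
  rw [LinearMap.BilinForm.isSymm_iff_basis (Pi.basisFun R ι)]
  intro i j
  simp [coordForm, Matrix.toBilin'_single, LinearMap.BilinForm.toMatrix_apply, M.symm (m i)]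

theorem det_coordForm (R : Type) [CommRing R] :
    (LinearMap.BilinForm.toMatrix (Pi.basisFun R ι) (M.coordForm m R)).det =
      ((LinearMap.BilinForm.toMatrix m M.form).det : R) := by
  rw [LinearMap.BilinForm.toMatrix_basisFun, coordForm, LinearMap.BilinForm.toMatrix'_toBilin']
  exact (RingHom.map_det (Int.castRingHom R) _).symm

theorem coordForm_rat_pos {x : ι → ℚ} (hx : x ≠ 0) : 0 < M.coordForm m ℚ x x := by
  obtain ⟨N, hN⟩ := IsLocalization.exist_integer_multiples_of_finite (nonZeroDivisors ℤ) x
  choose z hz using hN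
  have hN0 : ((N : ℤ) : ℚ) ≠ 0 := by exact_mod_cast nonZeroDivisors.ne_zero N.2
  have hy : M.coords m ℚ (∑ i, z i • m i) = ((N : ℤ) : ℚ) • x := by
    ext i
    rw [coords_apply, m.repr_sum_self]
    have := hz i
    simpa using this
  have h := M.coordForm_coords m ℚ (∑ i, z i • m i) (∑ i, z i • m i)
  have hne : (∑ i, z i • m i) ≠ 0 := by
    intro h0
    rw [h0, map_zero] at hy
    exact smul_ne_zero hN0 hx hy.symm
  have hpos : (0 : ℚ) < (M.form (∑ i, z i • m i) (∑ i, z i • m i) : ℤ) := by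
    exact_mod_cast M.posDef _ hne
  rw [← h, hy] at hpos
  simp only [map_smul, LinearMap.smul_apply, smul_eq_mul, ← mul_assoc] at hpos
  exact pos_of_mul_pos_right hpos (mul_self_nonneg _)

/-- An orthogonal basis over `ℚ` has positive diagonal Gram matrix, and its determinant differs from
this one by a square. -/
theorem gram_det_pos : 0 < (LinearMap.BilinForm.toMatrix m M.form).det := by
  have : Invertible (2 : ℚ) := invertibleOfNonzero two_ne_zero
  obtain ⟨w, hw⟩ := LinearMap.BilinForm.exists_orthogonal_basis
    (LinearMap.BilinForm.isSymm_iff.1 (M.coordForm_isSymm m ℚ))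
  obtain ⟨a, ha, h⟩ := exists_det_toMatrix_eq_mul_sq (M.coordForm m ℚ) (Pi.basisFun ℚ ι) w
  have hdiag : LinearMap.BilinForm.toMatrix w (M.coordForm m ℚ) =
      Matrix.diagonal fun i => M.coordForm m ℚ (w i) (w i) := by
    ext i j
    rw [LinearMap.BilinForm.toMatrix_apply]
    by_cases hij : i = j
    · simp [hij]
    · rw [Matrix.diagonal_apply_ne _ hij]
      exact hw hij
  rw [det_coordForm, hdiag, Matrix.det_diagonal] at h
  have hpos : 0 < ∏ i, M.coordForm m ℚ (w i) (w i) :=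
    Finset.prod_pos fun i _ => M.coordForm_rat_pos m (w.ne_zero i)
  rw [h] at hpos
  exact_mod_cast pos_of_mul_pos_left hpos (sq_nonneg a)

/-- The second half is the obstruction: no family with Gram matrix `I_k ⊕ 0_3` modulo `p` is
independent in `M/pM`. Independence is phrased by divisibility of integer coefficients. -/
theorem exists_prime_orthogonal_family (M : PosDefLattice.{u}) {k : ℕ} (hM : M.rank = k + 6) :
    ∃ p : ℕ, p.Prime ∧ p ≠ 2 ∧
      (∃ (b : Fin k ⊕ Fin 6 → M.carrier) (δ : ZMod p), δ ≠ 0 ∧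
        ∀ i j, (M.form (b i) (b j) : ZMod p) =
          if i = j then (if i = Sum.inr 5 then δ else 1) else 0) ∧
      ∀ g : Fin k ⊕ Fin 3 → M.carrier,
        (∀ i j, (M.form (g i) (g j) : ZMod p) = if i = j ∧ i.isLeft then 1 else 0) →
        ¬ ∀ (c : Fin k ⊕ Fin 3 → ℤ) (w : M.carrier), ∑ i, c i • g i = (p : ℤ) • w →
          ∀ i, (p : ℤ) ∣ c i := by
  let m : Module.Basis (Fin (Module.finrank ℤ M.carrier)) ℤ M.carrier :=
    Module.finBasis ℤ M.carrier
  have hdpos := M.gram_det_pos m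
  set d := (LinearMap.BilinForm.toMatrix m M.form).det with hd
  obtain ⟨p, hp, hp2, hdp, hsq⟩ := exists_prime_not_isSquare_neg d.toNat (by omega)
  have hdcast : ((d.toNat : ℕ) : ZMod p) = (d : ZMod p) := by
    rw [← Int.cast_natCast, Int.toNat_of_nonneg hdpos.le]
  rw [hdcast] at hdp hsq
  have := Fact.mk hp
  have hV : Module.finrank (ZMod p) (Fin (Module.finrank ℤ M.carrier) → ZMod p) = k + 6 := by
    rw [Module.finrank_fin_fun]
    exact hM
  refine ⟨p, hp, hp2, ?_, fun g hg hind => ?_⟩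
  · obtain ⟨v, δ, hδ, hv⟩ := exists_orthogonal_family (F := ZMod p)
      (by rwa [ZMod.ringChar_zmod_n]) (k + 5) (M.coordForm m (ZMod p)) (M.coordForm_isSymm m _)
      (LinearMap.BilinForm.nondegenerate_of_det_ne_zero _ (Pi.basisFun (ZMod p) _)
        (by rwa [det_coordForm])) hV
    choose r hr using M.coords_surjective m p
    -- The reversal moves the exceptional value `δ` from index `0` to the last index.
    let e : Fin k ⊕ Fin 6 ≃ Fin (k + 6) := finSumFinEquiv.trans Fin.revPerm
    have he : ∀ i, e i = 0 ↔ i = Sum.inr 5 := by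
      intro i
      have : e (Sum.inr 5) = 0 := by
        simp [e, Fin.ext_iff, Fin.val_rev]
      rw [← this, e.injective.eq_iff]
    refine ⟨fun i => r (v (e i)), δ, hδ, fun i j => ?_⟩
    rw [← M.coordForm_coords m, hr, hr, hv]
    simp only [e.injective.eq_iff]
    simp only [← he]
  · apply hsq
    have h := isSquare_neg_det_of_radical (M.coordForm m (ZMod p)) (M.coordForm_isSymm m _)
      (Pi.basisFun (ZMod p) _) hV (fun i => M.coords m (ZMod p) (g i)) ?_
      (fun i j => by rw [M.coordForm_coords m, hg])
    · rwa [det_coordForm] at h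
    · rw [Fintype.linearIndependent_iff]
      intro c hc
      choose z hz using fun i => ZMod.intCast_surjective (n := p) (c i)
      have h0 : M.coords m (ZMod p) (∑ i, z i • g i) = 0 := by
        rw [← hc, map_sum]
        refine Finset.sum_congr rfl fun i _ => ?_
        rw [map_smul, ← hz, Int.cast_smul_eq_zsmul]
      obtain ⟨w, hw⟩ := M.exists_smul_of_coords_eq_zero m h0
      intro i
      rw [← hz, ZMod.intCast_zmod_eq_zero_iff_dvd]
      exact hind z w hw i

end PosDefLattice

/-! ### Saturation away from `p`. -/

section CoprimeSaturation

variable {E : Type*} [AddCommGroup E] {p : ℕ} {ι : Type*} [Fintype ι]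

/-- The vectors with a multiple in `N` by an integer prime to `p`. -/
def coprimeSaturation (hp : p.Prime) (N : Submodule ℤ E) : Submodule ℤ E where
  carrier := {w | ∃ m : ℤ, ¬ (p : ℤ) ∣ m ∧ m • w ∈ N}
  zero_mem' := ⟨1, (Nat.prime_iff_prime_int.1 hp).not_dvd_one, by simp⟩
  add_mem' := by
    rintro x y ⟨a, ha, hx⟩ ⟨b, hb, hy⟩
    refine ⟨a * b, (Nat.prime_iff_prime_int.1 hp).not_dvd_mul ha hb, ?_⟩
    rw [smul_add]
    refine N.add_mem ?_ ?_
    · rw [mul_comm, mul_smul]; exact N.smul_mem _ hx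
    · rw [mul_smul]; exact N.smul_mem _ hy
  smul_mem' := by
    rintro c x ⟨a, ha, hx⟩
    exact ⟨a, ha, by rw [smul_comm]; exact N.smul_mem _ hx⟩

theorem le_coprimeSaturation (hp : p.Prime) (N : Submodule ℤ E) : N ≤ coprimeSaturation hp N :=
  fun _ hx => ⟨1, (Nat.prime_iff_prime_int.1 hp).not_dvd_one, by simpa using hx⟩

variable (hp : p.Prime) {h : ι → E} {ψ : E →ₗ[ℤ] ℤ}

theorem dvd_of_mem_coprimeSaturation_span (hψ : ∀ i, (p : ℤ) ∣ ψ (h i)) {w : E}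
    (hw : w ∈ coprimeSaturation hp (Submodule.span ℤ (Set.range h))) : (p : ℤ) ∣ ψ w := by
  obtain ⟨m, hm, hw⟩ := hw
  obtain ⟨c, hc⟩ := (Submodule.mem_span_range_iff_exists_fun ℤ).1 hw
  have h1 : (p : ℤ) ∣ m * ψ w := by
    rw [← smul_eq_mul, ← map_smul, ← hc, map_sum]
    refine Finset.dvd_sum fun i _ => ?_
    rw [map_smul]
    exact (hψ i).mul_left _
  exact ((Nat.prime_iff_prime_int.1 hp).dvd_or_dvd h1).resolve_left hm

/-- The span is thus primitive among the vectors with `p ∣ ψ w`: the powers of `p` in `m` are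
removed one at a time by `hcore`, and the part of `m` prime to `p` is absorbed by the saturation. -/
theorem mem_coprimeSaturation_span_of_smul_mem [Module.Free ℤ E]
    (hcore : ∀ (c : ι → ℤ) (w : E), ∑ i, c i • h i = (p : ℤ) • w → (p : ℤ) ∣ ψ w →
      ∀ i, (p : ℤ) ∣ c i) {m : ℤ} (hm : m ≠ 0) {w : E} (hψw : (p : ℤ) ∣ ψ w)
    (hw : m • w ∈ Submodule.span ℤ (Set.range h)) :
    w ∈ coprimeSaturation hp (Submodule.span ℤ (Set.range h)) := by
  have hp0 : (p : ℤ) ≠ 0 := by exact_mod_cast hp.ne_zero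
  have hfin : FiniteMultiplicity (p : ℤ) m :=
    Int.finiteMultiplicity_iff.2 ⟨by simpa using hp.ne_one, hm⟩
  obtain ⟨c, hc, hpc⟩ := hfin.exists_eq_pow_mul_and_not_dvd
  refine ⟨c, hpc, ?_⟩
  rw [hc, mul_smul] at hw
  have key : ∀ (j : ℕ) (x : E), (p : ℤ) ∣ ψ x →
      (p : ℤ) ^ j • x ∈ Submodule.span ℤ (Set.range h) → x ∈ Submodule.span ℤ (Set.range h) := by
    intro j
    induction j with
    | zero => intro x _ hx; simpa using hx
    | succ j ih =>
      intro x hx hxm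
      refine ih x hx ?_
      obtain ⟨a, ha⟩ := (Submodule.mem_span_range_iff_exists_fun ℤ).1 hxm
      rw [pow_succ', mul_smul] at ha
      have hdiv := hcore a _ ha (by rw [map_smul]; exact hx.mul_left _)
      choose a' ha' using hdiv
      refine (Submodule.mem_span_range_iff_exists_fun ℤ).2 ⟨a', ?_⟩
      apply smul_right_injective _ hp0
      simp only [← ha, Finset.smul_sum, smul_smul, ← ha']
  exact key _ _ (by rw [map_smul]; exact hψw.mul_left _) hw

/-- Infinite descent: applying `hcore` with `w = 0` repeatedly makes the coefficients of a relation
divisible by every power of `p`. -/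
theorem linearIndependent_of_forall_dvd [Module.Free ℤ E] (hp : p.Prime)
    (hcore : ∀ (c : ι → ℤ) (w : E), ∑ i, c i • h i = (p : ℤ) • w → (p : ℤ) ∣ ψ w →
      ∀ i, (p : ℤ) ∣ c i) : LinearIndependent ℤ h := by
  have hp0 : (p : ℤ) ≠ 0 := by exact_mod_cast hp.ne_zero
  have key : ∀ (j : ℕ) (c : ι → ℤ), ∑ i, c i • h i = 0 → ∀ i, (p : ℤ) ^ j ∣ c i := by
    intro j
    induction j with
    | zero => intro c _ i; simp
    | succ j ih =>
      intro c hc i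
      have hdiv := hcore c 0 (by simpa using hc) (by simp)
      choose c' hc' using hdiv
      have h0 : ∑ i, c' i • h i = 0 := by
        apply smul_right_injective _ hp0
        refine Eq.trans ?_ (hc.trans (smul_zero _).symm)
        simp only [Finset.smul_sum, smul_smul, ← hc']
      rw [hc' i, pow_succ']
      exact mul_dvd_mul_left _ (ih c' h0 i)
  rw [Fintype.linearIndependent_iff]
  intro c hc i
  by_contra hne
  have hfin : FiniteMultiplicity (p : ℤ) (c i) :=
    Int.finiteMultiplicity_iff.2 ⟨by simpa using hp.ne_one, hne⟩
  obtain ⟨n, hn⟩ := hfin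
  exact hn (key _ c hc i)

theorem finrank_coprimeSaturation [Module.Free ℤ E] [Module.Finite ℤ E] (N : Submodule ℤ E) :
    Module.finrank ℤ (coprimeSaturation hp N) = Module.finrank ℤ N := by
  let N' : Submodule ℤ (coprimeSaturation hp N) := N.comap (coprimeSaturation hp N).subtype
  have h1 : Module.finrank ℤ N' = Module.finrank ℤ N :=
    (Submodule.comapSubtypeEquivOfLe (le_coprimeSaturation hp N)).finrank_eq
  have h2 := Submodule.finrank_quotient_add_finrank N'
  have h3 : Module.finrank ℤ (coprimeSaturation hp N ⧸ N') = 0 := by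
    rw [Module.finrank_eq_zero_iff_isTorsion]
    intro x
    obtain ⟨x, rfl⟩ := N'.mkQ_surjective x
    obtain ⟨m, hm, hx⟩ := x.2
    refine ⟨⟨m, mem_nonZeroDivisors_of_ne_zero (by rintro rfl; simp at hm)⟩, ?_⟩
    change m • N'.mkQ x = 0
    rw [← map_smul, Submodule.mkQ_apply, Submodule.Quotient.mk_eq_zero]
    exact hx
  omega

end CoprimeSaturation

/-! ### The degenerate family and the reflection vector. -/

namespace PosDefLattice

section RadicalFamily

variable {M : PosDefLattice.{u}} {p k : ℕ} (b : Fin k ⊕ Fin 6 → M.carrier) (X Y : ℤ)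

/-- A vector which is isotropic modulo `p` if `X ^ 2 + Y ^ 2 + 1` is divisible by `p` and `b` is
orthonormal modulo `p` at the first three indices of `Fin 6`. -/
def isotropicVector : M.carrier :=
  X • b (Sum.inr 0) + Y • b (Sum.inr 1) + b (Sum.inr 2)

/-- A family spanning a sublattice whose reduction modulo `p` has a radical of dimension three. -/
def radicalFamily (p : ℕ) : Fin k ⊕ Fin 3 → M.carrier :=
  Sum.elim (fun i => b (Sum.inl i))
    ![isotropicVector b X Y, (p : ℤ) • b (Sum.inr 2),
      (-Y) • b (Sum.inr 0) + X • b (Sum.inr 1) + b (Sum.inr 3)]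

variable {b X Y} {δ : ZMod p}
  (hb : ∀ i j, (M.form (b i) (b j) : ZMod p) =
    if i = j then (if i = Sum.inr 5 then δ else 1) else 0)
  (hXY : (X : ZMod p) ^ 2 + (Y : ZMod p) ^ 2 = -1)

include hb hXY in
theorem form_radicalFamily (i j : Fin k ⊕ Fin 3) :
    (M.form (radicalFamily b X Y p i) (radicalFamily b X Y p j) : ZMod p) =
      if i = j ∧ i.isLeft then 1 else 0 := by
  rcases i with i | i <;> rcases j with j | j
  · simp [radicalFamily, hb]
  · fin_cases j <;> simp [radicalFamily, isotropicVector, hb]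
  · fin_cases i <;> simp [radicalFamily, isotropicVector, hb]
  · fin_cases i <;> fin_cases j <;> simp [radicalFamily, isotropicVector, hb] <;>
      first | ring1 | linear_combination hXY

-- Pairing with `b` modulo `p` detects every coefficient except that of `p • b (Sum.inr 2)`. After
-- division by `p` that coefficient multiplies `b (Sum.inr 2)`, and `ψ` detects it.
include hb in
theorem dvd_of_sum_smul_radicalFamily (hp : p.Prime) {ψ : M.carrier →ₗ[ℤ] ℤ}
    (hψ : ∀ i, (p : ℤ) ∣ ψ (radicalFamily b X Y p i)) (hψ2 : ¬ (p : ℤ) ∣ ψ (b (Sum.inr 2)))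
    (c : Fin k ⊕ Fin 3 → ℤ) (w : M.carrier)
    (hc : ∑ i, c i • radicalFamily b X Y p i = (p : ℤ) • w) (hw : (p : ℤ) ∣ ψ w) :
    ∀ i, (p : ℤ) ∣ c i := by
  have hp0 : (p : ℤ) ≠ 0 := by exact_mod_cast hp.ne_zero
  have hpair : ∀ y, (M.form (∑ i, c i • radicalFamily b X Y p i) y : ZMod p) = 0 := by
    intro y
    rw [hc]
    simp
  have hl : ∀ i, (p : ℤ) ∣ c (Sum.inl i) := by
    intro i
    have := hpair (b (Sum.inl i))
    rw [← ZMod.intCast_zmod_eq_zero_iff_dvd]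
    simpa [radicalFamily, isotropicVector, Fin.sum_univ_three, hb] using this
  have h0 : (p : ℤ) ∣ c (Sum.inr 0) := by
    have := hpair (b (Sum.inr 2))
    rw [← ZMod.intCast_zmod_eq_zero_iff_dvd]
    simpa [radicalFamily, isotropicVector, Fin.sum_univ_three, hb] using this
  have h2 : (p : ℤ) ∣ c (Sum.inr 2) := by
    have := hpair (b (Sum.inr 3))
    rw [← ZMod.intCast_zmod_eq_zero_iff_dvd]
    simpa [radicalFamily, isotropicVector, Fin.sum_univ_three, hb] using this
  have h1 : (p : ℤ) ∣ c (Sum.inr 1) := by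
    choose cl hcl using hl
    obtain ⟨c0, hc0⟩ := h0
    obtain ⟨c2, hc2⟩ := h2
    have hw' : w = ∑ i, cl i • radicalFamily b X Y p (Sum.inl i) +
        (c0 • radicalFamily b X Y p (Sum.inr 0) + c (Sum.inr 1) • b (Sum.inr 2) +
          c2 • radicalFamily b X Y p (Sum.inr 2)) := by
      apply smul_right_injective _ hp0
      change (p : ℤ) • w = (p : ℤ) • _
      rw [← hc, Fintype.sum_sum_type, Fin.sum_univ_three, hc0, hc2]
      simp only [hcl, mul_smul, smul_add, Finset.smul_sum]
      congr 3
      exact smul_comm (c (Sum.inr 1)) (p : ℤ) (b (Sum.inr 2))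
    rw [hw'] at hw
    simp only [map_add, map_sum, map_smul, smul_eq_mul] at hw
    have hA : (p : ℤ) ∣ ∑ i, cl i * ψ (radicalFamily b X Y p (Sum.inl i)) :=
      Finset.dvd_sum fun i _ => (hψ _).mul_left _
    have hB := (hψ (Sum.inr 0)).mul_left c0
    have hC := (hψ (Sum.inr 2)).mul_left c2
    have hD : (p : ℤ) ∣ c (Sum.inr 1) * ψ (b (Sum.inr 2)) := by
      have := dvd_sub hw (dvd_add hA (dvd_add hB hC))
      convert! this using 1
      ring
    exact ((Nat.prime_iff_prime_int.1 hp).dvd_or_dvd hD).resolve_right hψ2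
  rintro (i | i)
  · exact hl i
  · fin_cases i
    · exact h0
    · exact h1
    · exact h2

include hb hXY in
/-- Every coset of a lattice `M` in a larger lattice contains a vector `v` whose reflection
produces a neighbor in which the sublattice spanned by `radicalFamily` is primitive at `p`. -/
theorem exists_reflection_vector (hp : p.Prime) (hp2 : p ≠ 2) (hδ : δ ≠ 0) {L : PosDefLattice.{u}}
    (σ : M.carrier →ₗ[ℤ] L.carrier) (hσ : ∀ x y, L.form (σ x) (σ y) = M.form x y)
    (x₀ : L.carrier) :
    ∃ (m : M.carrier) (t : ℤ), L.form (x₀ + σ m) (x₀ + σ m) = p * t ∧ ¬ (p : ℤ) ∣ t ∧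
      (∀ i, (p : ℤ) ∣ L.form (σ (radicalFamily b X Y p i)) (x₀ + σ m)) ∧
      ¬ (p : ℤ) ∣ L.form (σ (b (Sum.inr 2))) (x₀ + σ m) := by
  have := Fact.mk hp
  have hsurj := ZMod.intCast_surjective (n := p)
  -- As `M` is nondegenerate modulo `p`, the coset contains a vector orthogonal to `M` modulo `p`.
  obtain ⟨m₁, hm₁⟩ : ∃ m₁, ∀ j, (L.form (σ (b j)) (x₀ + σ m₁) : ZMod p) = 0 := by
    choose s hs using fun i => hsurj ((L.form (σ (b i)) x₀ : ZMod p) /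
      (if i = Sum.inr 5 then δ else 1))
    refine ⟨-∑ i, s i • b i, fun j => ?_⟩
    have hd : (if j = Sum.inr 5 then δ else 1) ≠ 0 := by split_ifs <;> simp [hδ]
    simp only [map_add, map_neg, hσ, map_sum, map_smul, smul_eq_mul]
    push_cast
    simp only [hb, mul_ite, mul_zero, Finset.sum_ite_eq, Finset.mem_univ, if_true]
    rw [← mul_ite, hs, div_mul_cancel₀ _ hd, add_neg_cancel]
  set x := x₀ + σ m₁ with hx
  obtain ⟨α', β', hαβ⟩ := exists_mul_sq_add_mul_sq_eq (F := ZMod p)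
    (by rwa [ZMod.ringChar_zmod_n]) one_ne_zero hδ (-(L.form x x : ZMod p))
  obtain ⟨α, rfl⟩ := hsurj α'
  obtain ⟨β, rfl⟩ := hsurj β'
  have hm₁' : ∀ j, (L.form x (σ (b j)) : ZMod p) = 0 := fun j => by rw [L.symm, hm₁]
  -- The indices `4` and `5`, not used by the family, cancel `Q x` modulo `p`; the isotropic vector
  -- leaves `Q` unchanged modulo `p`, is orthogonal to the family and pairs to `1` with `b (Sum.inr
  -- 2)`.
  let m₂ := α • b (Sum.inr 4) + β • b (Sum.inr 5) + isotropicVector b X Y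
  set w := x + σ m₂ with hw
  have hwb : ∀ j, (L.form (σ (b j)) w : ZMod p) = (M.form (b j) m₂ : ZMod p) := fun j => by
    rw [hw, map_add, hσ]
    push_cast
    rw [hm₁, zero_add]
  have hww : (L.form w w : ZMod p) = 0 := by
    have h1 : (L.form x (σ m₂) : ZMod p) = 0 := by
      simp [m₂, isotropicVector, hm₁']
    have h2 : (M.form m₂ m₂ : ZMod p) = α ^ 2 + δ * β ^ 2 := by
      simp [m₂, isotropicVector, hb]
      linear_combination hXY
    have h3 : L.form w w = L.form x x + 2 * L.form x (σ m₂) + M.form m₂ m₂ := by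
      rw [hw, ← hσ]
      simp only [map_add, LinearMap.add_apply]
      rw [L.symm (σ m₂) x]
      ring
    rw [h3]
    push_cast
    rw [h1, h2]
    linear_combination hαβ
  have hw2 : (L.form (σ (b (Sum.inr 2))) w : ZMod p) = 1 := by
    rw [hwb]
    simp [m₂, isotropicVector, hb]
  have main : ∀ c : ℤ, (p : ℤ) ∣ c →
      (∀ i, (p : ℤ) ∣ L.form (σ (radicalFamily b X Y p i)) (w + c • σ (b (Sum.inr 2)))) ∧
      ¬ (p : ℤ) ∣ L.form (σ (b (Sum.inr 2))) (w + c • σ (b (Sum.inr 2))) := by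
    intro c hc
    rw [← ZMod.intCast_zmod_eq_zero_iff_dvd] at hc
    have hred : ∀ y, (L.form y (w + c • σ (b (Sum.inr 2))) : ZMod p) = L.form y w := by
      intro y
      simp [hc]
    constructor
    · intro i
      rw [← ZMod.intCast_zmod_eq_zero_iff_dvd, hred]
      rcases i with i | i
      · simp [radicalFamily, hwb, m₂, isotropicVector, hb]
      · fin_cases i <;> simp [radicalFamily, hwb, m₂, isotropicVector, hb] <;>
          first | ring1 | linear_combination hXY
    · rw [← ZMod.intCast_zmod_eq_zero_iff_dvd, hred, hw2]
      exact one_ne_zero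
  have hmem : ∀ c : ℤ, x₀ + σ (m₁ + m₂ + c • b (Sum.inr 2)) = w + c • σ (b (Sum.inr 2)) := by
    intro c
    rw [hw, hx, map_add, map_add, map_smul]
    abel
  obtain ⟨q, hq⟩ := (ZMod.intCast_zmod_eq_zero_iff_dvd _ p).1 hww
  -- If `p² ∣ Q w`, adding `p • b (Sum.inr 2)` changes `Q w / p` by `2` modulo `p`, which is
  -- nonzero, and keeps all congruences modulo `p`.
  by_cases hpq : (p : ℤ) ∣ q
  · obtain ⟨q', rfl⟩ := hpq
    refine ⟨m₁ + m₂ + (p : ℤ) • b (Sum.inr 2), p * q' + 2 * L.form (σ (b (Sum.inr 2))) w +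
      p * M.form (b (Sum.inr 2)) (b (Sum.inr 2)), ?_, ?_, ?_⟩
    · rw [hmem, ← hσ]
      simp only [map_add, map_smul, LinearMap.add_apply, LinearMap.smul_apply, smul_eq_mul]
      rw [hq, L.symm w]
      ring
    · rw [← ZMod.intCast_zmod_eq_zero_iff_dvd]
      push_cast
      rw [hw2]
      simp only [CharP.cast_eq_zero, zero_mul, zero_add, add_zero, mul_one]
      exact Ring.two_ne_zero (by rwa [ZMod.ringChar_zmod_n])
    · rw [hmem]
      exact main p dvd_rfl
  · refine ⟨m₁ + m₂ + (0 : ℤ) • b (Sum.inr 2), q, ?_, hpq, ?_⟩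
    · rw [hmem, zero_smul, add_zero, hq]
    · rw [hmem]
      exact main 0 (dvd_zero _)

end RadicalFamily

end PosDefLattice

/-! ### Primitive representation by the neighbor. -/

namespace PosDefLattice

/-- A submodule of a lattice with the restricted form. -/
def sublattice (M : PosDefLattice.{u}) (N : Submodule ℤ M.carrier) : PosDefLattice.{u} where
  carrier := N
  form := M.form.restrict N
  symm x y := M.symm x y
  posDef x hx := M.posDef x (by simpa using hx)

theorem primitivelyRepresents_sublattice_iff {L M : PosDefLattice.{u}}
    {N : Submodule ℤ M.carrier} :
    L.PrimitivelyRepresents (M.sublattice N) ↔ ∃ τ : N →ₗ[ℤ] L.carrier, Function.Injective τ ∧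
      (∀ x y : N, L.form (τ x) (τ y) = M.form x y) ∧ ∃ P, IsCompl (LinearMap.range τ) P :=
  Iff.rfl

/-- The embedding is `p σ`, matching the scaling of the neighbor. A vector of the neighbor in the
space of `M` must be `p σ y` with `p ∣ B(σ y, v)`, and among such `y` the saturated span is
primitive by `hcore`. -/
theorem neighbor_primitivelyRepresents {L M : PosDefLattice.{u}} {p : ℕ} {t : ℤ} {v : L.carrier}
    (hp : p.Prime) (hp2 : p ≠ 2) (hv : L.form v v = p * t) (ht : ¬ (p : ℤ) ∣ t)
    {σ : M.carrier →ₗ[ℤ] L.carrier} (hσ : Function.Injective σ)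
    (hσform : ∀ x y, L.form (σ x) (σ y) = M.form x y) {P : Submodule ℤ L.carrier}
    (hP : IsCompl (LinearMap.range σ) P) {φ : L.carrier →ₗ[ℤ] ℤ} (hφ : ∀ x, φ (σ x) = 0)
    (hφv : φ v = 1) {ι : Type} [Fintype ι] {h : ι → M.carrier}
    (hh : ∀ i, (p : ℤ) ∣ L.form (σ (h i)) v)
    (hcore : ∀ (c : ι → ℤ) (w : M.carrier), ∑ i, c i • h i = (p : ℤ) • w →
      (p : ℤ) ∣ L.form (σ w) v → ∀ i, (p : ℤ) ∣ c i) :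
    (neighbor hp hv ht).PrimitivelyRepresents
      (M.sublattice (coprimeSaturation hp (Submodule.span ℤ (Set.range h)))) := by
  have hp0 : (p : ℤ) ≠ 0 := by exact_mod_cast hp.ne_zero
  have hpp := Nat.prime_iff_prime_int.1 hp
  set K := coprimeSaturation hp (Submodule.span ℤ (Set.range h))
  let ψ : M.carrier →ₗ[ℤ] ℤ := L.form.flip v ∘ₗ σ
  have hKψ : ∀ x ∈ K, (p : ℤ) ∣ L.form (σ x) v := fun x hx =>
    dvd_of_mem_coprimeSaturation_span hp (ψ := ψ) hh hx
  have hmem : ∀ x : K, (p : ℤ) • σ x ∈ L.neighborSubmodule v p := by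
    intro x
    obtain ⟨s, hs⟩ := hKψ x x.2
    refine (mem_neighborSubmodule L).2 ⟨t • σ x - (2 * s) • v, ?_⟩
    rw [scaledReflection_apply, hv, map_smul, LinearMap.smul_apply, hs, smul_eq_mul]
    module
  let τ : K →ₗ[ℤ] L.neighborSubmodule v p :=
    LinearMap.codRestrict _ (LinearMap.lsmul ℤ L.carrier (p : ℤ) ∘ₗ σ ∘ₗ K.subtype) hmem
  have hτ : ∀ x, (τ x : L.carrier) = (p : ℤ) • σ x := fun _ => rfl
  refine primitivelyRepresents_sublattice_iff.2 ⟨τ, fun x y hxy => ?_, fun x y => ?_,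
    exists_isCompl_of_smul_mem (E := L.neighborSubmodule v p) (LinearMap.range τ) ?_⟩
  · have h1 : (p : ℤ) • σ x = (p : ℤ) • σ y := congrArg Subtype.val hxy
    exact Subtype.ext (hσ (smul_right_injective _ hp0 h1))
  · apply mul_left_cancel₀ (pow_ne_zero 2 hp0)
    refine (sq_mul_neighbor_form hp hv ht (τ x) (τ y)).trans ?_
    rw [hτ, hτ]
    simp only [map_smul, LinearMap.smul_apply, smul_eq_mul, hσform]
    ring
  · rintro m ⟨x, hx⟩ hm ⟨k, hk⟩
    have hk' : (p : ℤ) • σ k = m • x := congrArg Subtype.val hk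
    obtain ⟨x', rfl⟩ : x ∈ LinearMap.range σ :=
      mem_of_smul_mem_of_isCompl hP hm (hk' ▸ ⟨(p : ℤ) • k.1, map_smul σ _ _⟩)
    obtain ⟨l, hl⟩ := (mem_neighborSubmodule L).1 hx
    rw [scaledReflection_apply, hv] at hl
    -- The functional `φ` kills `σ x'` and equals `1` on `v`, so it reads off the coefficient of `v`
    -- in the scaled reflection.
    have h2 : (p : ℤ) ^ 2 ∣ 2 * L.form (σ x') v := by
      have := congrArg φ hl
      simp only [map_sub, map_smul, hφ, hφv, smul_eq_mul, mul_zero, mul_one, zero_sub] at this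
      exact ⟨-φ l, by linear_combination -this⟩
    have hco : IsCoprime ((p : ℤ) ^ 2) 2 := by
      refine IsCoprime.pow_left (hpp.coprime_iff_not_dvd.2 fun hdvd => hp2 ?_)
      exact (Nat.prime_dvd_prime_iff_eq hp Nat.prime_two).1 (by exact_mod_cast hdvd)
    obtain ⟨s, hs⟩ := hco.dvd_of_dvd_mul_left h2
    rw [hs] at hl
    have h3 : t • σ x' = (p : ℤ) • (l + (2 * s) • v) := by
      apply smul_right_injective _ hp0
      change (p : ℤ) • t • σ x' = (p : ℤ) • (p : ℤ) • (l + (2 * s) • v)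
      have : (p * t : ℤ) • σ x' = (p : ℤ) ^ 2 • l + (2 * ((p : ℤ) ^ 2 * s)) • v := by
        rw [← hl, sub_add_cancel]
      rw [smul_smul, this]
      module
    -- Bézout for `p` and `t` turns `t • σ x' ∈ p L` into `σ x' ∈ p L`.
    obtain ⟨a, b, hab⟩ := hpp.coprime_iff_not_dvd.2 ht
    have h4 : σ x' = (p : ℤ) • (a • σ x' + b • (l + (2 * s) • v)) := by
      have h5 : σ x' = (a * p + b * t) • σ x' := by rw [hab, one_smul]
      conv_lhs => rw [h5, add_smul, mul_smul b t, h3]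
      module
    obtain ⟨y, hy⟩ : a • σ x' + b • (l + (2 * s) • v) ∈ LinearMap.range σ :=
      mem_of_smul_mem_of_isCompl hP hp0 (h4 ▸ ⟨x', rfl⟩)
    rw [← hy] at h4
    have hyψ : (p : ℤ) ∣ L.form (σ y) v := by
      rw [h4, map_smul, LinearMap.smul_apply, smul_eq_mul, sq, mul_assoc] at hs
      exact ⟨s, mul_left_cancel₀ hp0 hs⟩
    have hmy : m • y = k.1 := by
      apply hσ
      apply smul_right_injective _ hp0
      change (p : ℤ) • σ (m • y) = (p : ℤ) • σ k
      rw [hk', h4, map_smul, smul_comm]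
    obtain ⟨c, hc, hck⟩ := k.2
    have hyK : y ∈ K := by
      refine mem_coprimeSaturation_span_of_smul_mem hp (ψ := ψ) hcore
        (m := c * m) (mul_ne_zero (by rintro rfl; simp at hc) hm) hyψ ?_
      rwa [mul_smul, hmy]
    exact ⟨⟨y, hyK⟩, Subtype.ext h4.symm⟩

theorem successiveMinimum_succ_le {L M : PosDefLattice.{u}} {σ : M.carrier →ₗ[ℤ] L.carrier}
    (hσ : Function.Injective σ) (hσform : ∀ x y, L.form (σ x) (σ y) = M.form x y)
    {P : Submodule ℤ L.carrier} (hP : IsCompl (LinearMap.range σ) P) {n : ℕ}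
    (m : Module.Basis (Fin n) ℤ M.carrier) {C : ℕ} (hC : ∀ i, M.form (m i) (m i) ≤ C)
    {x : L.carrier} (hx : x ∉ LinearMap.range σ) (hxC : L.form x x ≤ C) :
    L.successiveMinimum (n + 1) ≤ C := by
  refine Nat.sInf_le ⟨Fin.cons x (fun i => σ (m i)), ?_, ?_⟩
  · refine LinearIndependent.finCons' x _
      (m.linearIndependent.map' σ (LinearMap.ker_eq_bot.2 hσ)) fun c y hy hcy => ?_
    by_contra hc
    refine hx (mem_of_smul_mem_of_isCompl hP hc ?_)
    rw [eq_neg_of_add_eq_zero_left hcy]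
    refine (LinearMap.range σ).neg_mem (Submodule.span_le.2 ?_ hy)
    rintro _ ⟨i, rfl⟩
    exact ⟨m i, rfl⟩
  · intro j
    refine Fin.cases ?_ (fun i => ?_) j
    · simpa using hxC
    · simpa [hσform] using hC i

end PosDefLattice

/-! ### Proof of the bound. -/

open PosDefLattice in
theorem proposition5p1 (n : ℕ) (hn : 6 ≤ n) (M : PosDefLattice.{u}) (hM : M.rank = n) :
    ∃ C : ℝ, ∀ L : PosDefLattice.{u},
      n < L.rank → L.IsStrictlyRegular (n - 3) → L.PrimitivelyRepresents M →
        (L.successiveMinimum (n + 1) : ℝ) ≤ C := by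
  obtain ⟨k, rfl⟩ : ∃ k, n = k + 6 := ⟨n - 6, by omega⟩
  obtain ⟨p, hp, hp2, ⟨b, δ, hδ, hb⟩, hnon⟩ := exists_prime_orthogonal_family M hM
  have := Fact.mk hp
  have hp0 : (p : ℤ) ≠ 0 := by exact_mod_cast hp.ne_zero
  obtain ⟨X, Y, hXY⟩ : ∃ X Y : ℤ, (X : ZMod p) ^ 2 + (Y : ZMod p) ^ 2 = -1 := by
    obtain ⟨x, y, h⟩ := exists_mul_sq_add_mul_sq_eq (F := ZMod p)
      (by rwa [ZMod.ringChar_zmod_n]) one_ne_zero one_ne_zero (-1)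
    obtain ⟨X, rfl⟩ := ZMod.intCast_surjective x
    obtain ⟨Y, rfl⟩ := ZMod.intCast_surjective y
    exact ⟨X, Y, by simpa using h⟩
  set h := radicalFamily b X Y p
  set N := coprimeSaturation hp (Submodule.span ℤ (Set.range h)) with hN
  -- Applied to `M` itself, this yields a functional that controls `N` before any `L` is given, so
  -- `N` and the constant depend only on `M`.
  obtain ⟨m₀, t₀, -, -, hψ₀, hψ₀'⟩ := exists_reflection_vector hb hXY hp hp2 hδ
    LinearMap.id (fun _ _ => rfl) (0 : M.carrier)
  let ψ₀ : M.carrier →ₗ[ℤ] ℤ := M.form.flip (0 + m₀)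
  have hcore₀ := dvd_of_sum_smul_radicalFamily hb hp (ψ := ψ₀) hψ₀ hψ₀'
  have hlin : LinearIndependent ℤ h := linearIndependent_of_forall_dvd hp hcore₀
  have hrank : (M.sublattice N).rank = k + 6 - 3 := by
    have h1 : (M.sublattice N).rank = Module.finrank ℤ N := rfl
    rw [h1, hN, finrank_coprimeSaturation, finrank_span_eq_card hlin]
    simp
  let m : Module.Basis (Fin (k + 6)) ℤ M.carrier := Module.finBasisOfFinrankEq ℤ _ hM
  let κ := Module.finBasis ℤ N
  have hform_nonneg : ∀ x, 0 ≤ M.form x x := fun x => by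
    rcases eq_or_ne x 0 with rfl | hx
    · simp
    · exact (M.posDef x hx).le
  let C : ℕ := (∑ i, M.form (m i) (m i) + ∑ i, M.form (κ i) (κ i)).toNat
  have hC : (C : ℤ) = ∑ i, M.form (m i) (m i) + ∑ i, M.form (κ i) (κ i) :=
    Int.toNat_of_nonneg (add_nonneg (Finset.sum_nonneg fun i _ => hform_nonneg _)
      (Finset.sum_nonneg fun i _ => hform_nonneg _))
  have hCm : ∀ i, M.form (m i) (m i) ≤ C := fun i => by
    rw [hC]
    exact le_add_of_le_of_nonneg (Finset.single_le_sum (f := fun i => M.form (m i) (m i))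
      (fun i _ => hform_nonneg _) (Finset.mem_univ i)) (Finset.sum_nonneg fun i _ => hform_nonneg _)
  have hCκ : ∀ i, M.form (κ i) (κ i) ≤ C := fun i => by
    rw [hC]
    exact le_add_of_nonneg_of_le (Finset.sum_nonneg fun i _ => hform_nonneg _)
      (Finset.single_le_sum (f := fun i => M.form (κ i : M.carrier) (κ i))
        (fun i _ => hform_nonneg _) (Finset.mem_univ i))
  refine ⟨C, fun L hL hreg hrep => ?_⟩
  obtain ⟨σ, hσ, hσform, P, hP⟩ := hrep
  rw [Nat.cast_le]
  have hrange : Module.finrank ℤ (LinearMap.range σ) = k + 6 := by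
    rw [LinearMap.finrank_range_of_inj hσ]
    exact hM
  obtain ⟨φ, hφ, x₀, hx₀⟩ := exists_functional_of_isCompl hP (hrange.trans_lt hL)
  have hφσ : ∀ x, φ (σ x) = 0 := fun x => hφ _ ⟨x, rfl⟩
  obtain ⟨m₁, t, hv, ht, hψ, hψ'⟩ := exists_reflection_vector hb hXY hp hp2 hδ σ hσform x₀
  have hgenus : L.GenusPrimitivelyRepresents (M.sublattice N) :=
    ⟨_, neighbor_inGenus hp hv ht, neighbor_primitivelyRepresents hp hp2 hv ht hσ hσform hP hφσ
      (by rw [map_add, hφσ, hx₀, add_zero]) hψ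
      (dvd_of_sum_smul_radicalFamily hb hp (ψ := L.form.flip (x₀ + σ m₁) ∘ₗ σ) hψ hψ')⟩
  obtain ⟨τ, hτ, hτform, P', hP'⟩ :=
    primitivelyRepresents_sublattice_iff.1 (hreg _ hrank hgenus)
  by_contra hlt
  -- A basis vector of `N` sent outside `σ(M)` would already give the bound.
  have hκ : ∀ i, τ (κ i) ∈ LinearMap.range σ := fun i => by
    by_contra hi
    exact hlt (successiveMinimum_succ_le hσ hσform hP m hCm hi
      ((hτform (κ i) (κ i)).trans_le (hCκ i)))
  have hτσ : ∀ x, τ x ∈ LinearMap.range σ := fun x => by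
    have hx : x ∈ Submodule.span ℤ (Set.range κ) := by rw [κ.span_eq]; trivial
    refine (Submodule.span_le (p := (LinearMap.range σ).comap τ)).2 ?_ hx
    rintro _ ⟨i, rfl⟩
    exact hκ i
  let h' : Fin k ⊕ Fin 3 → N := fun i =>
    ⟨h i, le_coprimeSaturation hp _ (Submodule.subset_span ⟨i, rfl⟩)⟩
  choose g hg using fun i => hτσ (h' i)
  -- The whole image of `τ` now lies in `σ(M)`; pulled back to `M`, the family keeps its Gram matrix
  -- and, as `τ(N)` is primitive in `L`, stays independent modulo `p`, against the choice of `p`.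
  refine hnon g (fun i j => ?_) fun c w hcw => ?_
  · rw [← hσform, hg, hg, hτform]
    exact form_radicalFamily hb hXY i j
  · have h1 : τ (∑ i, c i • h' i) = (p : ℤ) • σ w := by
      rw [← map_smul, ← hcw, map_sum, map_sum]
      exact Finset.sum_congr rfl fun i _ => by
        rw [map_smul, map_smul, hg]
    obtain ⟨w', hw'⟩ : σ w ∈ LinearMap.range τ :=
      mem_of_smul_mem_of_isCompl hP' hp0 ⟨_, h1⟩
    have h2 : ∑ i, c i • h' i = (p : ℤ) • w' := by
      apply hτ
      rw [h1, ← hw', map_smul]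
    have h3 : ∑ i, c i • h i = (p : ℤ) • w'.1 := by
      have := congrArg N.subtype h2
      simpa [h'] using this
    exact hcore₀ c _ h3 (dvd_of_mem_coprimeSaturation_span hp (ψ := ψ₀) hψ₀ w'.2)
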